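/- Let $d\ge1$. For $L>0$ put $\Omega_L=(-L,L)^d$, $\langle v\rangle=\sqrt{1+|v|^2}$, and for $F:\mathbb R^d\to\mathbb R$ and $s\ge 0$ put $m_s(F)=\int_{\mathbb R^d}|F(v)|\langle v\rangle^s\,dv$; functions on $\Omega_L$ are extended by zero to $\mathbb R^d$. For $0\le\lambda\le1$ let $a_{ij}(z)=|z|^{\lambda+2}\bigl(\delta_{ij}-z_iz_j/|z|^2\bigr)$ and $b_i=\sum_j\partial_j a_{ij}=-(d-1)|z|^\lambda z_i$, and let $Q$ be the Landau operator $$Q(F,G)=\nabla_v\cdot\int_{\mathbb R^d} a(v-w)\bigl(G(w)\nabla F(v)-F(v)\nabla G(w)\bigr)\,dw,$$ understood in the sense of distributions: $\langle Q(F,G),\psi\rangle=\int F\bigl(\sum_{i,j}(a_{ij}*G)\,\partial_i\partial_j\psi+2\sum_i(b_i*G)\,\partial_i\psi\bigr)dv$. Let $0<\delta<1$ and $\chi(v)=\varphi(v/L)$, where $\varphi:\mathbb R^d\to[0,1]$ is smooth, supported in $(1-\delta/5)[-1,1]^d$ and equal to $1$ on $(1-\delta)[-1,1]^d$. For $R>0$,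 $N\in\mathbb N$ let $\Pi^N_R$ be the mode projection on $\Omega_R$, $$\Pi^N_R T(v)=\frac1{(2R)^d}\sum_{n\in\mathbb Z^d,\ |n_i|\le N}\langle T,e^{-i\xi_n\cdot w}\rangle\,e^{i\xi_n\cdot v},\qquad \xi_n=\tfrac{\pi}{R}n .$$ For $f\in L^2(\Omega_L)$ let $Q_u(f,f)=\Pi^N_{2L}Q(\chi f,\chi f)$ be the unconserved operator, and let the conserved operator $Q_c(f,f)$ be the minimiser of $\int_{\Omega_L}(Q_u(f,f)-X)^2dv$ over all $X\in L^2(\Omega_L)$ with $\int_{\Omega_L}X=\int_{\Omega_L}Xv_j=\int_{\Omega_L}X|v|^2=0$, $j=1,\dots,d$. The $L^2(\Omega_L)$ norm of a distribution that is not an $L^2(\Omega_L)$ function is $+\infty$. In what follows $O_r$ denotes a function of $L$ such that $|O_r(L)|\le A\,L^{-r}$ for all $L\ge1$. **Theorem.** (a) There is a constant $C_d>0$ depending only on $d$ such that for all $k\ge0$ and $k'\ge2$ there are functions $O_{-k}$ (depending only on $d,k$) and $O_{\frac d2+k'-k}$ (depending only on $d,k,k'$) such that for all $0\le\lambda\le1$,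 $L>0$, $N\in\mathbb N$, all $\delta$ and $\varphi$ as above and all $f\in L^2(\Omega_L)$, $$\bigl\|(Q_u(f,f)-Q_c(f,f))\langle v\rangle^k\bigr\|_{L^2(\Omega_L)}\le\frac{C_d}{\sqrt{2k+1}}\Bigl(O_{-k}\,\bigl\|(\Pi^N_{2L}-1)Q(\chi f,\chi f)\bigr\|_{L^2(\Omega_L)}$$ $$\qquad+\,O_{\frac d2+k'-k}\bigl(m_0(f)m_{k'+\lambda}(f)+m_\lambda(f)m_{k'}(f)+m_2(f)m_{k'+\lambda-2}(f)+m_{\lambda+2}(f)m_{k'-2}(f)\bigr)\Bigr).$$ (b) For $k=0$, $k'=2$: there are a constant $C_d>0$ (possibly different) and a function $O_{\frac d2+2}$, both depending only on $d$, such that for all $\lambda,L,N,\delta,\varphi,f$ as in (a), $$\|Q_u(f,f)-Q_c(f,f)\|_{L^2(\Omega_L)}\le C_d\Bigl(\bigl\|(\Pi^N_{2L}-1)Q(\chi f,\chi f)\bigr\|_{L^2(\Omega_L)}+O_{\frac d2+2}\bigl(m_0(f)m_{2+\lambda}(f)+m_\lambda(f)m_2(f)\bigr)\Bigr).$$ 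-/

import Mathlib

open Set Filter Topology MeasureTheory Asymptotics
open scoped ContDiff ENNReal

noncomputable section

namespace Landau

/-- Velocity space `ℝ^d` with its Euclidean norm. -/
abbrev V (d : ℕ) : Type := EuclideanSpace ℝ (Fin d)

variable {d : ℕ}

/-- The open cube `Ω_L = (-L, L)^d`. -/
def cube (d : ℕ) (L : ℝ) : Set (V d) := {v | ∀ i, |v i| < L}

/-- The weight `⟨v⟩ = √(1 + |v|²)`. -/
def bracket (v : V d) : ℝ := Real.sqrt (1 + ‖v‖ ^ 2)

/-- The moment `m_k(F) = ∫_{ℝ^d} |F(v)| ⟨v⟩^k dv`. -/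
def moment (k : ℝ) (F : V d → ℝ) : ℝ := ∫ v, |F v| * bracket v ^ k

/-- Extension by zero of a function on `Ω_L` to the whole of `ℝ^d`. -/
def zeroExt (L : ℝ) (f : V d → ℝ) : V d → ℝ := (cube d L).indicator f

/-- Profiles of the cut-off: smooth functions `ℝ^d → [0,1]` with support in
`(1 - δ/5)[-1,1]^d` that are equal to `1` on `(1 - δ)[-1,1]^d`. -/
structure IsCutoffProfile (δ : ℝ) (φ : V d → ℝ) : Prop where
  smooth : ContDiff ℝ ∞ φ
  mem_unit : ∀ v, φ v ∈ Icc (0 : ℝ) 1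
  support_subset : tsupport φ ⊆ {v | ∀ i, |v i| ≤ 1 - δ / 5}
  eq_one : ∀ v : V d, (∀ i, |v i| ≤ 1 - δ) → φ v = 1

/-- The function `χ f` on `ℝ^d`, with `χ(v) = φ(v / L)` and `f` extended by zero. -/
def cutoffMul (L : ℝ) (φ f : V d → ℝ) : V d → ℝ := fun v => φ (L⁻¹ • v) * zeroExt L f v

/-- Partial derivative `∂φ/∂v_i`. -/
def partialD (i : Fin d) (φ : V d → ℝ) (v : V d) : ℝ := fderiv ℝ φ v (EuclideanSpace.single i 1)

/-- The matrix `a_{ij}(z) = |z|^{lam+2} (δ_{ij} - z_i z_j / |z|²)`. -/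
def kerA (lam : ℝ) (i j : Fin d) (z : V d) : ℝ :=
  ‖z‖ ^ (lam + 2) * ((if i = j then 1 else 0) - z i * z j / ‖z‖ ^ 2)

/-- The vector `b_i = ∑_j ∂_j a_{ij}`, that is `b_i(z) = -(d - 1) |z|^lam z_i`
(see `sum_partialD_kerA`). In dimension three the factor is `-2`. -/
def kerB (lam : ℝ) (i : Fin d) (z : V d) : ℝ := -((d : ℝ) - 1) * ‖z‖ ^ lam * z i

theorem sum_partialD_kerA (lam : ℝ) (i : Fin d) {z : V d} (hz : z ≠ 0) :
    ∑ j, partialD j (kerA lam i j) z = kerB lam i z := by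
  have hn : ‖z‖ ≠ 0 := norm_ne_zero_iff.mpr hz
  have hpos : 0 < ‖z‖ := norm_pos_iff.mpr hz
  have hsq : ∑ j, z j ^ 2 = ‖z‖ ^ 2 := by
    rw [EuclideanSpace.norm_sq_eq]; simp
  have key : ∀ j, partialD j (kerA lam i j) z
      = (lam + 2) * ‖z‖ ^ lam * z j * (if i = j then 1 else 0)
        - (lam * (‖z‖ ^ lam / ‖z‖ ^ 2) * z i * z j ^ 2
          + ‖z‖ ^ lam * ((if i = j then 1 else 0) * z j + z i)) := by
    intro j
    have hloc : kerA lam i j =ᶠ[𝓝 z] fun w =>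
        (‖w‖ ^ 2) ^ ((lam + 2) / 2) * (if i = j then 1 else 0)
          - (‖w‖ ^ 2) ^ (lam / 2) * (w i * w j) := by
      filter_upwards [isOpen_ne.mem_nhds hz] with w hw
      have hwp : 0 < ‖w‖ := norm_pos_iff.mpr hw
      have e1 : (‖w‖ ^ 2) ^ ((lam + 2) / 2) = ‖w‖ ^ (lam + 2) := by
        rw [← Real.rpow_natCast, ← Real.rpow_mul hwp.le]; congr 1; push_cast; ring
      have e2 : (‖w‖ ^ 2) ^ (lam / 2) = ‖w‖ ^ lam := by
        rw [← Real.rpow_natCast, ← Real.rpow_mul hwp.le]; congr 1; push_cast; ring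
      have e3 : ‖w‖ ^ (lam + 2) = ‖w‖ ^ lam * ‖w‖ ^ 2 := by
        rw [Real.rpow_add hwp]; norm_num
      rw [e1, e2, kerA, e3]
      field_simp
    have hsqd : HasFDerivAt (fun w : V d => ‖w‖ ^ 2) (2 • innerSL ℝ z) z :=
      (hasStrictFDerivAt_norm_sq z).hasFDerivAt
    have hc : ∀ l : Fin d, HasFDerivAt (fun w : V d => w l)
        (EuclideanSpace.proj l : V d →L[ℝ] ℝ) z :=
      fun l => (EuclideanSpace.proj l : V d →L[ℝ] ℝ).hasFDerivAt
    have hp : ‖z‖ ^ 2 ≠ 0 := pow_ne_zero _ hn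
    have hd := ((hsqd.rpow_const (p := (lam + 2) / 2) (Or.inl hp)).mul_const
      (if i = j then (1 : ℝ) else 0)).sub
      ((hsqd.rpow_const (p := lam / 2) (Or.inl hp)).mul ((hc i).mul (hc j)))
    have e1 : (‖z‖ ^ 2) ^ ((lam + 2) / 2 - 1) = ‖z‖ ^ lam := by
      rw [← Real.rpow_natCast, ← Real.rpow_mul hpos.le]; congr 1; push_cast; ring
    have e2 : (‖z‖ ^ 2) ^ (lam / 2) = ‖z‖ ^ lam := by
      rw [← Real.rpow_natCast, ← Real.rpow_mul hpos.le]; congr 1; push_cast; ring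
    have e3 : (‖z‖ ^ 2) ^ (lam / 2 - 1) = ‖z‖ ^ lam / ‖z‖ ^ 2 := by
      rw [Real.rpow_sub (by positivity), e2, Real.rpow_one]
    have hin : inner ℝ z (EuclideanSpace.single j (1 : ℝ)) = z j := by
      simp [EuclideanSpace.inner_single_right]
    rw [partialD, hloc.fderiv_eq]
    erw [hd.fderiv]
    simp only [e1, e2, e3, sub_apply, add_apply,
      smul_apply, innerSL_apply_apply, hin, PiLp.proj_apply,
      PiLp.single_apply, smul_eq_mul, nsmul_eq_mul]
    by_cases h : i = j
    · subst h; simp; ring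
    · simp [h]; ring
  simp only [key, Finset.sum_sub_distrib, Finset.sum_add_distrib, ← Finset.mul_sum, hsq, kerB]
  simp only [mul_ite, mul_one, mul_zero, ite_mul, one_mul, zero_mul,
    Finset.sum_ite_eq, Finset.mem_univ, if_true, Finset.sum_const, Finset.card_univ,
    Fintype.card_fin, nsmul_eq_mul]
  field_simp
  ring

/-- Convolution `(K * G)(v) = ∫ K(v - w) G(w) dw`. -/
def conv (K G : V d → ℝ) (v : V d) : ℝ := ∫ w, K (v - w) * G w

/-- The Landau operator
`Q(F,G) = ∇_v · ∫ S(v - w) (G(w) ∇F(v) - F(v) ∇G(w)) dw = ∑_{ij} ∂_i (ā_{ij} ∂_j F) - ∑_i ∂_i (b̄_i F)`,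
`ā = a * G`, `b̄ = b * G`, in the sense of distributions: all derivatives are moved to `φ`,
`⟨Q(F,G), φ⟩ = ∫ F (∑_{ij} ā_{ij} ∂_i ∂_j φ + 2 ∑_i b̄_i ∂_i φ) dv`. It is used for compactly
supported `F`, `G`, so that it may be paired with every smooth `φ`. -/
def collision (lam : ℝ) (F G : V d → ℝ) (φ : V d → ℝ) : ℝ :=
  ∫ v, F v * ((∑ i, ∑ j, conv (kerA lam i j) G v * partialD i (partialD j φ) v)
    + 2 * ∑ i, conv (kerB lam i) G v * partialD i φ v)

/-- The frequencies `ξ_n = (π / R) n`, `n ∈ ℤ^d`, of the Fourier series on `Ω_R`. -/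
def freq (R : ℝ) (n : Fin d → ℤ) : V d := WithLp.toLp 2 fun i => Real.pi / R * (n i : ℝ)

/-- `⟨T, e^{-i ξ·w}⟩` for a real functional `T` on smooth functions of `w`. -/
def fourierCoeff (T : (V d → ℝ) → ℝ) (ξ : V d) : ℂ :=
  (T (fun w => Real.cos (inner ℝ ξ w)) : ℂ) - (T (fun w => Real.sin (inner ℝ ξ w)) : ℂ) * Complex.I

/-- The mode projection on `Ω_R`: the truncated Fourier series
`Π^N_R T (v) = (2R)^{-d} ∑_{|n_i| ≤ N} ⟨T, e^{-i ξ_n·w}⟩ e^{i ξ_n·v}`. The sum is symmetric under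
`n ↦ -n`, hence real; `re` only records its real value as a real number. -/
def modeProj (R : ℝ) (N : ℕ) (T : (V d → ℝ) → ℝ) (v : V d) : ℝ :=
  (((2 * R) ^ d : ℝ)⁻¹ * ∑ n ∈ Fintype.piFinset (fun _ : Fin d => Finset.Icc (-(N : ℤ)) N),
    fourierCoeff T (freq R n) * Complex.exp (Complex.I * (inner ℝ (freq R n) v : ℝ))).re

/-- The unconserved operator `Q_u(f,f) = Π^N_{2L} Q(χ f, χ f)`. -/
def unconservedOp (lam L : ℝ) (N : ℕ) (φ f : V d → ℝ) : V d → ℝ :=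
  modeProj (2 * L) N (collision lam (cutoffMul L φ f) (cutoffMul L φ f))

/-- The distribution `(Π^N_{2L} - 1) Q(χ f, χ f)`. -/
def spectralError (lam L : ℝ) (N : ℕ) (φ f : V d → ℝ) (ψ : V d → ℝ) : ℝ :=
  (∫ v, unconservedOp lam L N φ f v * ψ v)
    - collision lam (cutoffMul L φ f) (cutoffMul L φ f) ψ

/-- `T` restricted to the open set `Ω` is the function `g ∈ L²(Ω)`. -/
def Represents (Ω : Set (V d)) (T : (V d → ℝ) → ℝ) (g : V d → ℝ) : Prop :=
  MemLp g 2 (volume.restrict Ω) ∧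
    ∀ ψ : V d → ℝ, ContDiff ℝ ∞ ψ → HasCompactSupport ψ → tsupport ψ ⊆ Ω →
      T ψ = ∫ v in Ω, g v * ψ v

/-- The `L²(Ω)` norm of a distribution: the norm of the `L²(Ω)` function that it is (unique up
to null sets), and `∞` if it is not an `L²(Ω)` function. -/
def distL2Norm (Ω : Set (V d)) (T : (V d → ℝ) → ℝ) : ℝ≥0∞ :=
  ⨅ (g : V d → ℝ) (_ : Represents Ω T g), eLpNorm g 2 (volume.restrict Ω)

/-- The space `B` of the `L²(Ω_L)` functions with vanishing mass, momentum and energy. -/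
def MemConserved (L : ℝ) (X : V d → ℝ) : Prop :=
  MemLp X 2 (volume.restrict (cube d L)) ∧
    (∫ v in cube d L, X v = 0) ∧ (∀ i, ∫ v in cube d L, X v * v i = 0) ∧
    (∫ v in cube d L, X v * ‖v‖ ^ 2 = 0)

/-- `X` minimises `∫_{Ω_L} (h - X)²` over `B`. With `h = Q_u(f,f)` this says `X = Q_c(f,f)`. -/
def IsConservedPart (L : ℝ) (h X : V d → ℝ) : Prop :=
  MemConserved L X ∧
    ∀ Y, MemConserved L Y →
      ∫ v in cube d L, (h v - X v) ^ 2 ≤ ∫ v in cube d L, (h v - Y v) ^ 2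

theorem memLp_cube_of_continuous {g : V d → ℝ} (hg : Continuous g) (L : ℝ) :
    MemLp g 2 (volume.restrict (cube d L)) := by
  have hK : IsCompact (Metric.closedBall (0 : V d) (Real.sqrt (d * L ^ 2))) :=
    isCompact_closedBall _ _
  have hsub : cube d L ⊆ Metric.closedBall (0 : V d) (Real.sqrt (d * L ^ 2)) := by
    intro v hv
    rw [mem_closedBall_zero_iff, EuclideanSpace.norm_eq]
    apply Real.sqrt_le_sqrt
    calc ∑ i, ‖v i‖ ^ 2 ≤ ∑ _i : Fin d, L ^ 2 := by
          refine Finset.sum_le_sum fun i _ => ?_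
          have := hv i
          rw [← Real.norm_eq_abs] at this
          exact pow_le_pow_left₀ (norm_nonneg _) this.le 2
      _ = d * L ^ 2 := by simp
  obtain ⟨C, hC⟩ := hK.exists_bound_of_continuousOn hg.continuousOn
  have : IsFiniteMeasure (volume.restrict (Metric.closedBall (0 : V d) (Real.sqrt (d * L ^ 2)))) :=
    ⟨by rw [Measure.restrict_apply_univ]; exact hK.measure_lt_top⟩
  refine (MemLp.of_bound hg.aestronglyMeasurable C ?_).mono_measure
    (Measure.restrict_mono hsub le_rfl)
  exact (ae_restrict_iff' hK.measurableSet).2 (Eventually.of_forall hC)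

theorem continuous_unconservedOp (lam L : ℝ) (N : ℕ) (φ f : V d → ℝ) :
    Continuous (unconservedOp lam L N φ f) := by
  unfold unconservedOp modeProj
  fun_prop

/-- The conserved operator exists. -/
theorem exists_isConservedPart (L : ℝ) {h : V d → ℝ}
    (hh : MemLp h 2 (volume.restrict (cube d L))) : ∃ X, IsConservedPart L h X := by
  set μ := volume.restrict (cube d L) with hμ
  have h1 : MemLp (fun _ : V d => (1 : ℝ)) 2 μ := memLp_cube_of_continuous continuous_const L
  have h2 : ∀ i, MemLp (fun v : V d => v i) 2 μ := fun i =>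
    memLp_cube_of_continuous (by fun_prop) L
  have h3 : MemLp (fun v : V d => ‖v‖ ^ 2) 2 μ := memLp_cube_of_continuous (by fun_prop) L
  have hinner : ∀ {a b : V d → ℝ} (ha : MemLp a 2 μ) (hb : MemLp b 2 μ),
      inner ℝ (ha.toLp a) (hb.toLp b) = ∫ v, b v * a v ∂μ := by
    intro a b ha hb
    rw [L2.inner_def]
    refine integral_congr_ae ?_
    filter_upwards [ha.coeFn_toLp, hb.coeFn_toLp] with v e1 e2
    rw [e1, e2]; rfl
  let w : Option (Option (Fin d)) → Lp ℝ 2 μ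
    | none => h1.toLp _
    | some none => h3.toLp _
    | some (some i) => (h2 i).toLp _
  let K : Submodule ℝ (Lp ℝ 2 μ) := Submodule.span ℝ (Set.range w)
  have hK : ∀ {Y : V d → ℝ} (hY : MemLp Y 2 μ), MemConserved L Y ↔ hY.toLp Y ∈ Kᗮ := by
    intro Y hY
    have : hY.toLp Y ∈ Kᗮ ↔ ∀ o, inner ℝ (w o) (hY.toLp Y) = 0 := by
      rw [Submodule.mem_orthogonal]
      refine ⟨fun H o => H _ (Submodule.subset_span ⟨o, rfl⟩), fun H u hu => ?_⟩
      induction hu using Submodule.span_induction with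
      | mem x hx => obtain ⟨o, rfl⟩ := hx; exact H o
      | zero => simp
      | add x y _ _ hx hy => rw [inner_add_left, hx, hy, add_zero]
      | smul a x _ hx => rw [inner_smul_left, hx, mul_zero]
    rw [this]
    constructor
    · rintro ⟨-, m1, m2, m3⟩ o
      match o with
      | none => simpa [w, hinner] using m1
      | some none => simpa [w, hinner] using m3
      | some (some i) => simpa [w, hinner] using m2 i
    · intro H
      refine ⟨hY, ?_, fun i => ?_, ?_⟩
      · simpa [w, hinner] using H none
      · simpa [w, hinner] using H (some (some i))
      · simpa [w, hinner] using H (some none)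
  have : FiniteDimensional ℝ K := FiniteDimensional.span_of_finite ℝ (Set.finite_range w)
  have hnorm : ∀ {Y : V d → ℝ} (hY : MemLp Y 2 μ),
      ∫ v, (h v - Y v) ^ 2 ∂μ = ‖hh.toLp h - hY.toLp Y‖ ^ 2 := by
    intro Y hY
    rw [← MemLp.toLp_sub, ← real_inner_self_eq_norm_sq, hinner]
    simp [sq]
  have hX : MemLp (⇑(Kᗮ.starProjection (hh.toLp h))) 2 μ := Lp.memLp _
  have hXe : hX.toLp _ = Kᗮ.starProjection (hh.toLp h) := Lp.toLp_coeFn _ _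
  refine ⟨_, (hK hX).2 (by rw [hXe]; exact Submodule.starProjection_apply_mem _ _), fun Y hY => ?_⟩
  rw [hnorm hX, hnorm hY.1, hXe]
  have hmem := (hK hY.1).1 hY
  gcongr
  rw [Submodule.starProjection_minimal]
  exact ciInf_le ⟨0, by rintro _ ⟨y, rfl⟩; exact norm_nonneg _⟩ (⟨_, hmem⟩ : Kᗮ)

end Landau

end

namespace Landau

variable {d : ℕ}

/-! The weak Landau operator conserves mass, momentum and energy of `F = χ f` exactly: tested
against `1`, `v_j`, `|v|²`, it becomes a double integral of `F ⊗ F` against an antisymmetric kernel,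
or zero outright (`collision_coord`, `collision_norm_sq`, `collision_one`). These polynomials are
not compactly supported in the cube, but `F` vanishes outside a strictly smaller closed cube, so
they may be multiplied by cut-offs equal to `1` near it without changing the pairing; exhausting the
cube removes the cut-offs.

Hence, if the spectral error is `g ∈ L²(Ω_L)`, then `Q_u - g`, which is `Q(χ f, χ f)` on `Ω_L`, lies
in the constraint space `B` (`memConserved_sub`). It competes in the minimisation defining `Q_c`, so
`‖Q_u - Q_c‖ ≤ ‖g‖`. This is (b) already without moment terms. For (a), the weight is at most `√(1 +
d L²)^k` on the cube. -/

/-! ### Open and closed cubes -/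

theorem isOpen_cube (L : ℝ) : IsOpen (cube d L) := by
  simp only [cube, ofPred_forall]
  exact isOpen_iInter_of_finite fun i => isOpen_lt (by fun_prop) continuous_const

/-- The closed cube `[-r, r]^d`. -/
def closedCube (d : ℕ) (r : ℝ) : Set (V d) := {v | ∀ i, |v i| ≤ r}

theorem isClosed_closedCube (r : ℝ) : IsClosed (closedCube d r) := by
  simp only [closedCube, ofPred_forall]
  exact isClosed_iInter fun i => isClosed_le (by fun_prop) continuous_const

theorem norm_le_of_abs_le {r : ℝ} {v : V d} (hv : ∀ i, |v i| ≤ r) :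
    ‖v‖ ≤ Real.sqrt (d * r ^ 2) := by
  rw [EuclideanSpace.norm_eq]
  apply Real.sqrt_le_sqrt
  calc ∑ i, ‖v i‖ ^ 2 ≤ ∑ _i : Fin d, r ^ 2 :=
        Finset.sum_le_sum fun i _ => pow_le_pow_left₀ (norm_nonneg _) (hv i) 2
    _ = d * r ^ 2 := by simp

theorem closedCube_subset_closedBall (r : ℝ) :
    closedCube d r ⊆ Metric.closedBall 0 (Real.sqrt (d * r ^ 2)) := fun _ hv =>
  mem_closedBall_zero_iff.2 (norm_le_of_abs_le hv)

theorem isCompact_closedCube (r : ℝ) : IsCompact (closedCube d r) :=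
  (isCompact_closedBall _ _).of_isClosed_subset (isClosed_closedCube r)
    (closedCube_subset_closedBall r)

theorem cube_subset_closedCube (L : ℝ) : cube d L ⊆ closedCube d L := fun _ hv i => (hv i).le

instance isFiniteMeasure_restrict_cube (L : ℝ) :
    IsFiniteMeasure (volume.restrict (cube d L)) :=
  ⟨by
    rw [Measure.restrict_apply_univ]
    exact (measure_mono (cube_subset_closedCube L)).trans_lt
      (isCompact_closedCube L).measure_lt_top⟩

/-! ### The kernels -/

theorem continuous_norm_rpow {s : ℝ} (hs : 0 ≤ s) : Continuous fun z : V d => ‖z‖ ^ s :=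
  continuous_norm.rpow_const fun _ => Or.inr hs

/-- The quotient `z_i z_j / |z|²` has no limit at `0`; absorbing `|z|²` into the power leaves
`|z|^lam z_i z_j`, which is continuous for `lam ≥ 0`. -/
theorem continuous_kerA {lam : ℝ} (hlam : 0 ≤ lam) (i j : Fin d) :
    Continuous (kerA lam i j) := by
  have h : kerA lam i j = fun z : V d =>
      ‖z‖ ^ (lam + 2) * (if i = j then 1 else 0) - ‖z‖ ^ lam * (z i * z j) := by
    funext z
    rcases eq_or_ne z 0 with rfl | hz
    · simp [kerA]
    · have hp : 0 < ‖z‖ := norm_pos_iff.mpr hz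
      have e : ‖z‖ ^ (lam + 2) = ‖z‖ ^ lam * ‖z‖ ^ 2 := by
        rw [Real.rpow_add hp]; norm_num
      rw [kerA, e]
      field_simp
  rw [h]
  have h1 := continuous_norm_rpow (d := d) hlam
  have h2 := continuous_norm_rpow (d := d) (s := lam + 2) (by linarith)
  fun_prop

theorem continuous_kerB {lam : ℝ} (hlam : 0 ≤ lam) (i : Fin d) :
    Continuous (kerB lam i) := by
  have h1 := continuous_norm_rpow (d := d) hlam
  unfold kerB
  fun_prop

theorem kerB_neg (lam : ℝ) (i : Fin d) (z : V d) : kerB lam i (-z) = -kerB lam i z := by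
  simp [kerB]

theorem kerA_neg (lam : ℝ) (i j : Fin d) (z : V d) : kerA lam i j (-z) = kerA lam i j z := by
  simp [kerA]

/-- The cancellation behind energy conservation: `tr a(z) = (d - 1)|z|^(lam+2)` and `b(z)·z` is its
negative. -/
theorem sum_kerA_diag_add_kerB {lam : ℝ} (hlam : 0 ≤ lam) (z : V d) :
    ∑ i, kerA lam i i z + ∑ i, kerB lam i z * z i = 0 := by
  rcases eq_or_ne z 0 with rfl | hz
  · have : lam + 2 ≠ 0 := by linarith
    simp [kerA, kerB, Real.zero_rpow this]
  · have hp : 0 < ‖z‖ := norm_pos_iff.mpr hz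
    have hsq : ∑ j, z j * z j = ‖z‖ ^ 2 := by
      rw [EuclideanSpace.norm_sq_eq]; simp [sq]
    have e : ‖z‖ ^ (lam + 2) = ‖z‖ ^ lam * ‖z‖ ^ 2 := by
      rw [Real.rpow_add hp]; norm_num
    simp only [kerA, kerB, if_true, ← Finset.mul_sum, Finset.sum_sub_distrib, ← Finset.sum_div,
      mul_assoc, hsq, e]
    simp
    field_simp
    ring

/-! ### Exact conservation of mass, momentum and energy -/

theorem integrable_mul_of_continuous_of_support {X : Type*} [TopologicalSpace X]
    [MeasurableSpace X] [OpensMeasurableSpace X] {μ : Measure X} {F H : X → ℝ} {K : Set X}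
    (hF : Integrable F μ) (hK : IsCompact K) (hFK : ∀ x ∉ K, F x = 0) (hH : Continuous H) :
    Integrable (fun x => F x * H x) μ := by
  obtain ⟨C, hC⟩ := hK.exists_bound_of_continuousOn hH.continuousOn
  refine (hF.norm.mul_const C).mono' (hF.1.mul hH.measurable.aestronglyMeasurable)
    (Eventually.of_forall fun x => ?_)
  by_cases hx : x ∈ K
  · rw [norm_mul]
    exact mul_le_mul_of_nonneg_left (hC x hx) (norm_nonneg _)
  · simp [hFK x hx]

/-- Integrals of antisymmetric kernels against `F ⊗ F` vanish. -/
theorem integral_integral_eq_zero_of_antisymm {F : V d → ℝ} {K : Set (V d)}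
    (hF : Integrable F) (hK : IsCompact K) (hFK : ∀ x ∉ K, F x = 0) {H : V d → V d → ℝ}
    (hH : Continuous fun p : V d × V d => H p.1 p.2) (hanti : ∀ v w, H v w + H w v = 0) :
    ∫ v, F v * ∫ w, F w * H v w = 0 := by
  -- Fubini needs absolute integrability; compact support of `F` makes any continuous `H`
  -- admissible, whatever its growth.
  have hint : Integrable (fun p : V d × V d => F p.1 * F p.2 * H p.1 p.2)
      (volume.prod volume) := by
    refine integrable_mul_of_continuous_of_support (hF.mul_prod hF) (hK.prod hK) ?_ hH
    rintro ⟨v, w⟩ hvw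
    by_cases hv : v ∈ K
    · have hw : w ∉ K := fun hw => hvw ⟨hv, hw⟩
      simp [hFK w hw]
    · simp [hFK v hv]
  have e : ∫ v, F v * ∫ w, F w * H v w = ∫ v, ∫ w, F v * F w * H v w := by
    congr 1; funext v
    rw [← integral_const_mul]
    simp only [mul_assoc]
  have hswap := integral_integral_swap (f := fun v w => F v * F w * H v w) hint
  have hneg : ∫ w, ∫ v, F v * F w * H v w = -∫ v, ∫ w, F v * F w * H v w := by
    rw [← integral_neg]
    congr 1; funext w
    rw [← integral_neg]
    congr 1; funext v
    have := hanti v w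
    have hw : H v w = -H w v := by linarith
    rw [hw]; ring
  rw [e]
  rw [hneg] at hswap
  linarith

theorem partialD_const (i : Fin d) (c : ℝ) : partialD i (fun _ : V d => c) = fun _ => 0 := by
  funext v; simp [partialD]

theorem partialD_coord (i j : Fin d) :
    partialD i (fun v : V d => v j) = fun _ => if i = j then 1 else 0 := by
  funext v
  have h : HasFDerivAt (fun w : V d => w j) (EuclideanSpace.proj j : V d →L[ℝ] ℝ) v :=
    (EuclideanSpace.proj j : V d →L[ℝ] ℝ).hasFDerivAt
  rw [partialD, h.fderiv]
  simp [eq_comm]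

theorem partialD_norm_sq (i : Fin d) :
    partialD i (fun v : V d => ‖v‖ ^ 2) = fun v => 2 * v i := by
  funext v
  have h : HasFDerivAt (fun w : V d => ‖w‖ ^ 2) (2 • innerSL ℝ v) v :=
    (hasStrictFDerivAt_norm_sq v).hasFDerivAt
  rw [partialD, h.fderiv]
  simp [EuclideanSpace.inner_single_right]

theorem partialD_two_mul_coord (i j : Fin d) :
    partialD i (fun v : V d => 2 * v j) = fun _ => if i = j then 2 else 0 := by
  funext v
  have h : HasFDerivAt (fun w : V d => 2 * w j)
      ((2 : ℝ) • (EuclideanSpace.proj j : V d →L[ℝ] ℝ)) v :=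
    (EuclideanSpace.proj j : V d →L[ℝ] ℝ).hasFDerivAt.const_mul 2
  rw [partialD, h.fderiv]
  simp [eq_comm]

theorem collision_one (lam : ℝ) (F G : V d → ℝ) : collision lam F G (fun _ => 1) = 0 := by
  simp [collision, partialD_const]

theorem conv_eq (K G : V d → ℝ) (v : V d) : conv K G v = ∫ w, G w * K (v - w) := by
  simp only [conv, mul_comm]

/-- Only the first-order term survives, with kernel `2 b_j(v - w)`, and `b` is odd. -/
theorem collision_coord {lam : ℝ} (hlam : 0 ≤ lam) {F : V d → ℝ} {K : Set (V d)}
    (hF : Integrable F) (hK : IsCompact K) (hFK : ∀ x ∉ K, F x = 0) (j : Fin d) :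
    collision lam F F (fun v => v j) = 0 := by
  have e : ∀ v, F v * ((∑ i, ∑ l, conv (kerA lam i l) F v * partialD i (partialD l fun v => v j) v)
      + 2 * ∑ i, conv (kerB lam i) F v * partialD i (fun v => v j) v)
      = F v * ∫ w, F w * (2 * kerB lam j (v - w)) := by
    intro v
    simp only [partialD_coord, partialD_const, mul_zero, Finset.sum_const_zero, mul_ite, mul_one,
      Finset.sum_ite_eq', Finset.mem_univ, if_true, zero_add, conv_eq]
    rw [← integral_const_mul]
    simp only [mul_left_comm]
  simp only [collision, e]
  have hB := continuous_kerB (d := d) hlam j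
  refine integral_integral_eq_zero_of_antisymm hF hK hFK (by fun_prop) fun v w => ?_
  rw [← neg_sub v w, kerB_neg]; ring

/-- The kernel is `2 tr a(z) + 4 b(z)·v` with `z = v - w`. Since `a` is even and `b` odd, adding the
swapped kernel gives `4 (tr a(z) + b(z)·z) = 0`. -/
theorem collision_norm_sq {lam : ℝ} (hlam : 0 ≤ lam) {F : V d → ℝ} {K : Set (V d)}
    (hF : Integrable F) (hK : IsCompact K) (hFK : ∀ x ∉ K, F x = 0) :
    collision lam F F (fun v => ‖v‖ ^ 2) = 0 := by
  have hA := fun i : Fin d => continuous_kerA hlam i i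
  have hB := fun i : Fin d => continuous_kerB hlam i
  have e : ∀ v, F v * ((∑ i, ∑ l, conv (kerA lam i l) F v *
        partialD i (partialD l fun v => ‖v‖ ^ 2) v)
      + 2 * ∑ i, conv (kerB lam i) F v * partialD i (fun v => ‖v‖ ^ 2) v)
      = F v * ∫ w, F w * (2 * ∑ i, kerA lam i i (v - w)
          + 4 * ∑ i, kerB lam i (v - w) * v i) := by
    intro v
    have hAi : ∀ i : Fin d, Integrable fun w => F w * kerA lam i i (v - w) := fun i =>
      integrable_mul_of_continuous_of_support hF hK hFK (by have := hA i; fun_prop)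
    have hBi : ∀ i : Fin d, Integrable fun w => F w * kerB lam i (v - w) := fun i =>
      integrable_mul_of_continuous_of_support hF hK hFK (by have := hB i; fun_prop)
    have e1 : ∀ w, F w * (2 * ∑ i, kerA lam i i (v - w) + 4 * ∑ i, kerB lam i (v - w) * v i)
        = ∑ i, 2 * (F w * kerA lam i i (v - w))
          + ∑ i, 4 * v i * (F w * kerB lam i (v - w)) := by
      intro w
      simp only [mul_add, Finset.mul_sum]
      congr 1 <;> exact Finset.sum_congr rfl fun i _ => by ring
    simp only [e1]
    rw [integral_add (integrable_finsetSum _ fun i _ => (hAi i).const_mul _)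
        (integrable_finsetSum _ fun i _ => (hBi i).const_mul _),
      integral_finsetSum _ fun i _ => (hAi i).const_mul _,
      integral_finsetSum _ fun i _ => (hBi i).const_mul _]
    simp only [integral_const_mul, partialD_norm_sq, partialD_two_mul_coord, mul_ite, mul_zero,
      Finset.sum_ite_eq, Finset.mem_univ, if_true, conv_eq, Finset.mul_sum]
    congr 2 <;> exact Finset.sum_congr rfl fun i _ => by ring
  simp only [collision, e]
  refine integral_integral_eq_zero_of_antisymm hF hK hFK (by fun_prop) fun v w => ?_
  have h := sum_kerA_diag_add_kerB hlam (v - w)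
  have h1 : ∑ i, kerB lam i (v - w) * (v - w) i
      = ∑ i, kerB lam i (v - w) * v i - ∑ i, kerB lam i (v - w) * w i := by
    rw [← Finset.sum_sub_distrib]
    exact Finset.sum_congr rfl fun i _ => by rw [PiLp.sub_apply]; ring
  simp only [← neg_sub v w, kerB_neg, kerA_neg, neg_mul, Finset.sum_neg_distrib]
  rw [h1] at h
  linarith

/-! ### Locality and exhaustion of the cube -/

/-- Only derivatives of the test function at points where `F ≠ 0` enter, so only its germs there
matter. This lets a polynomial be replaced by its product with a cut-off. -/
theorem collision_congr_of_eventuallyEq {lam : ℝ} {F G ψ₁ ψ₂ : V d → ℝ}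
    (h : ∀ v, F v ≠ 0 → ψ₁ =ᶠ[𝓝 v] ψ₂) : collision lam F G ψ₁ = collision lam F G ψ₂ := by
  unfold collision
  congr 1; funext v
  by_cases hv : F v = 0
  · simp [hv]
  have h1 : ∀ l : Fin d, partialD l ψ₁ =ᶠ[𝓝 v] partialD l ψ₂ := fun l =>
    ((h v hv).fderiv (𝕜 := ℝ)).mono fun x hx => by simp only [partialD, hx]
  have h2 : ∀ i l : Fin d, partialD i (partialD l ψ₁) v = partialD i (partialD l ψ₂) v :=
    fun i l => by rw [partialD, (h1 l).fderiv_eq, partialD]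
  have h3 : ∀ i : Fin d, partialD i ψ₁ v = partialD i ψ₂ v := fun i => (h1 i).eq_of_nhds
  simp only [h2, h3]

theorem exists_smooth_cutoff {r L : ℝ} (hrL : r < L) :
    ∃ η : V d → ℝ, ContDiff ℝ ∞ η ∧ HasCompactSupport η ∧ tsupport η ⊆ cube d L ∧
      (∀ v ∈ closedCube d r, η =ᶠ[𝓝 v] fun _ => 1) ∧ ∀ v, η v ∈ Icc (0 : ℝ) 1 := by
  obtain ⟨η, h0, h1, hη⟩ := exists_contMDiffMap_zero_one_nhds_of_isClosed (n := ⊤)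
    (modelWithCornersSelf ℝ (V d)) (isOpen_cube (d := d) L).isClosed_compl
    (isClosed_closedCube (d := d) r)
    (disjoint_compl_left_iff_subset.2 fun v hv i => (hv i).trans_lt hrL)
  have hsub : tsupport η ⊆ cube d L := fun v hv => by
    by_contra hc
    exact (notMem_tsupport_iff_eventuallyEq.2 (eventually_nhdsSet_iff_forall.1 h0 v hc)) hv
  refine ⟨η, contMDiff_iff_contDiff.1 η.contMDiff, ?_, hsub,
    fun v hv => eventually_nhdsSet_iff_forall.1 h1 v hv, hη⟩
  exact (isCompact_closedCube L).of_isClosed_subset (isClosed_tsupport _)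
    (hsub.trans (cube_subset_closedCube L))

/-- An `L²` function on the cube that annihilates `η p` for all smooth cut-offs `η` that are `1`
near a fixed smaller cube annihilates `p`. -/
theorem integral_mul_eq_zero_of_cutoff {r L : ℝ} (hrL : r < L) {u p : V d → ℝ}
    (hu : MemLp u 2 (volume.restrict (cube d L))) (hp : Continuous p)
    (h : ∀ η : V d → ℝ, ContDiff ℝ ∞ η → HasCompactSupport η → tsupport η ⊆ cube d L →
      (∀ v ∈ closedCube d r, η =ᶠ[𝓝 v] fun _ => 1) →
      ∫ v in cube d L, u v * (η v * p v) = 0) :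
    ∫ v in cube d L, u v * p v = 0 := by
  -- These half-widths start at `r` for `n = 0` and increase to `L`, so every cut-off is `1` near
  -- the fixed cube and the hypothesis applies to each.
  have hlt : ∀ n : ℕ, L - (L - r) / (n + 1) < L := fun n => by
    have : 0 < (L - r) / (n + 1 : ℝ) := div_pos (by linarith) (by positivity)
    linarith
  choose η hη hc hs h1 h01 using fun n : ℕ => exists_smooth_cutoff (d := d) (hlt n)
  have hle : ∀ n : ℕ, r ≤ L - (L - r) / (n + 1) := fun n => by
    have : (L - r) / (n + 1 : ℝ) ≤ L - r :=
      div_le_self (by linarith) (by have := n.cast_nonneg (α := ℝ); linarith)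
    linarith
  have hzero : ∀ n, ∫ v in cube d L, u v * (η n v * p v) = 0 := fun n =>
    h (η n) (hη n) (hc n) (hs n) fun v hv => h1 n v fun i => (hv i).trans (hle n)
  have hup : Integrable (fun v => u v * p v) (volume.restrict (cube d L)) :=
    hu.integrable_mul (memLp_cube_of_continuous hp L)
  have htend : Tendsto (fun n => ∫ v in cube d L, u v * (η n v * p v)) atTop
      (𝓝 (∫ v in cube d L, u v * p v)) := by
    refine tendsto_integral_of_dominated_convergence (fun v => ‖u v * p v‖) (fun n => ?_)
      hup.norm (fun n => Eventually.of_forall fun v => ?_) ?_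
    · exact hu.1.mul ((hη n).continuous.mul hp).aestronglyMeasurable
    · have := h01 n v
      rw [mul_left_comm, norm_mul, Real.norm_of_nonneg this.1]
      exact mul_le_of_le_one_left (norm_nonneg _) this.2
    -- Each point of the open cube eventually lies in the growing closed cubes, where the cut-off
    -- equals `1`.
    · refine (ae_restrict_iff' (isOpen_cube L).measurableSet).2 (Eventually.of_forall fun v hv => ?_)
      have hlim : Tendsto (fun n : ℕ => L - (L - r) / ((n : ℝ) + 1)) atTop (𝓝 L) := by
        simpa using tendsto_const_nhds.sub
          (tendsto_const_nhds.div_atTop (tendsto_natCast_atTop_atTop.atTop_add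
            (tendsto_const_nhds (x := (1 : ℝ)))) : Tendsto
              (fun n : ℕ => (L - r) / ((n : ℝ) + 1)) atTop (𝓝 0))
      have hev : ∀ᶠ n : ℕ in atTop, v ∈ closedCube d (L - (L - r) / (n + 1)) := by
        simp only [closedCube, mem_ofPred_eq, eventually_all]
        exact fun i => (hlim.eventually (lt_mem_nhds (hv i))).mono fun n hn => hn.le
      refine tendsto_const_nhds.congr' ?_
      filter_upwards [hev] with n hn
      rw [(h1 n v hn).eq_of_nhds, one_mul]
  simp only [hzero] at htend
  exact (tendsto_nhds_unique htend tendsto_const_nhds)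

/-! ### The function `χ f` -/

/-- The margin `δ/5` in the support of the profile leaves a gap between `χ f` and the boundary of
the cube, in which test functions can be cut off. -/
theorem cutoffMul_eq_zero {L δ : ℝ} (hL : 0 < L) {φ : V d → ℝ} (hφ : IsCutoffProfile δ φ)
    (f : V d → ℝ) {v : V d} (hv : v ∉ closedCube d (L * (1 - δ / 5))) :
    cutoffMul L φ f v = 0 := by
  have : φ (L⁻¹ • v) = 0 := by
    by_contra hne
    refine hv fun i => ?_
    have := hφ.support_subset (subset_tsupport _ hne) i
    rw [PiLp.smul_apply, smul_eq_mul, abs_mul, abs_inv, abs_of_pos hL,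
      inv_mul_le_iff₀ hL] at this
    exact this
  simp [cutoffMul, this]

theorem integrable_cutoffMul {L δ : ℝ} {φ f : V d → ℝ} (hφ : IsCutoffProfile δ φ)
    (hf : MemLp f 2 (volume.restrict (cube d L))) : Integrable (cutoffMul L φ f) := by
  have h : Integrable (zeroExt L f) :=
    (integrable_indicator_iff (isOpen_cube L).measurableSet).2 (hf.integrable one_le_two)
  have hφc : Continuous fun v : V d => φ (L⁻¹ • v) := hφ.smooth.continuous.comp (by fun_prop)
  refine h.bdd_mul (c := 1) hφc.aestronglyMeasurable (Eventually.of_forall fun v => ?_)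
  have := hφ.mem_unit (L⁻¹ • v)
  rw [Real.norm_of_nonneg this.1]
  exact this.2

/-! ### The projection estimate -/

/-- If the spectral error is the function `g ∈ L²(Ω_L)` then `Q_u - g`, which is `Q(χ f, χ f)` on
`Ω_L`, has vanishing mass, momentum and energy. -/
theorem memConserved_sub {lam L δ : ℝ} (hlam : 0 ≤ lam) (hL : 0 < L) (hδ : 0 < δ) {N : ℕ}
    {φ f g : V d → ℝ} (hφ : IsCutoffProfile δ φ) (hf : MemLp f 2 (volume.restrict (cube d L)))
    (hg : Represents (cube d L) (spectralError lam L N φ f) g) :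
    MemConserved L fun v => unconservedOp lam L N φ f v - g v := by
  set h := unconservedOp lam L N φ f with hh
  set F := cutoffMul L φ f with hFdef
  have hcont : Continuous h := continuous_unconservedOp lam L N φ f
  have hhL : MemLp h 2 (volume.restrict (cube d L)) := memLp_cube_of_continuous hcont L
  have hu : MemLp (fun v => h v - g v) 2 (volume.restrict (cube d L)) := hhL.sub hg.1
  have hF : Integrable F := integrable_cutoffMul hφ hf
  have hFK : ∀ v ∉ closedCube d (L * (1 - δ / 5)), F v = 0 := fun v hv =>
    cutoffMul_eq_zero hL hφ f hv
  have hK := isCompact_closedCube (d := d) (L * (1 - δ / 5))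
  have hrL : L * (1 - δ / 5) < L := by nlinarith [mul_pos hL hδ]
  have key : ∀ p : V d → ℝ, ContDiff ℝ ∞ p → collision lam F F p = 0 →
      ∫ v in cube d L, (h v - g v) * p v = 0 := by
    intro p hp hcol
    refine integral_mul_eq_zero_of_cutoff hrL hu hp.continuous fun η hη hc hs h1 => ?_
    have hs' : tsupport (fun v => η v * p v) ⊆ cube d L := (tsupport_mul_subset_left).trans hs
    have hψ := hη.mul hp
    have hrep := hg.2 _ hψ hc.mul_right hs'
    have hcol' : collision lam F F (fun v => η v * p v) = 0 := by
      rw [← hcol]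
      refine collision_congr_of_eventuallyEq fun v hv => ?_
      have hvK : v ∈ closedCube d (L * (1 - δ / 5)) := by
        by_contra hc
        exact hv (hFK v hc)
      filter_upwards [h1 v hvK] with x hx
      rw [hx, one_mul]
    have hset : ∫ v, h v * (η v * p v) = ∫ v in cube d L, h v * (η v * p v) := by
      refine (setIntegral_eq_integral_of_forall_compl_eq_zero fun v hv => ?_).symm
      have : η v * p v = 0 := by
        by_contra hne
        exact hv (hs' (subset_tsupport (fun v => η v * p v) hne))
      rw [this, mul_zero]
    -- With the collision term gone, the representation says `∫ h η p = ∫ g η p` over the cube.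
    rw [spectralError, ← hFdef, ← hh, hcol', hset, sub_zero] at hrep
    have hψL := memLp_cube_of_continuous hψ.continuous L
    simp only [sub_mul]
    exact (integral_sub (hhL.integrable_mul hψL) (hg.1.integrable_mul hψL)).trans
      (sub_eq_zero.2 hrep)
  refine ⟨hu, ?_, fun i => ?_, ?_⟩
  · simpa using key (fun _ => 1) contDiff_const (collision_one lam F F)
  · exact key _ (by fun_prop) (collision_coord hlam hF hK hFK i)
  · exact key _ (contDiff_norm_sq ℝ) (collision_norm_sq hlam hF hK hFK)

theorem eLpNorm_two_le_of_integral_sq_le {X : Type*} [MeasurableSpace X] {μ : Measure X}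
    {a b : X → ℝ} (ha : MemLp a 2 μ) (hb : MemLp b 2 μ)
    (h : ∫ x, a x ^ 2 ∂μ ≤ ∫ x, b x ^ 2 ∂μ) : eLpNorm a 2 μ ≤ eLpNorm b 2 μ := by
  rw [ha.eLpNorm_eq_integral_rpow_norm two_ne_zero ENNReal.ofNat_ne_top,
    hb.eLpNorm_eq_integral_rpow_norm two_ne_zero ENNReal.ofNat_ne_top]
  refine ENNReal.ofReal_le_ofReal (Real.rpow_le_rpow ?_ ?_ (by norm_num))
  · exact integral_nonneg fun x => by positivity
  · simpa using h

/-- The conservation correction is bounded by the spectral error. The collision operator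
conserves mass, momentum and energy of `χ f` exactly, so no moments of `f` enter. -/
theorem eLpNorm_unconservedOp_sub_le {lam L δ : ℝ} (hlam : 0 ≤ lam) (hL : 0 < L) (hδ : 0 < δ)
    {N : ℕ} {φ f Qc : V d → ℝ} (hφ : IsCutoffProfile δ φ)
    (hf : MemLp f 2 (volume.restrict (cube d L)))
    (hQ : IsConservedPart L (unconservedOp lam L N φ f) Qc) :
    eLpNorm (fun v => unconservedOp lam L N φ f v - Qc v) 2 (volume.restrict (cube d L))
      ≤ distL2Norm (cube d L) (spectralError lam L N φ f) := by
  -- It suffices to treat each representative `g`; if there is none, the right side is `∞`.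
  refine le_iInf₂ fun g hg => ?_
  have hhL := memLp_cube_of_continuous (continuous_unconservedOp lam L N φ f) L
  refine eLpNorm_two_le_of_integral_sq_le (hhL.sub hQ.1.1) hg.1 ?_
  -- The competitor is `Y = Q_u - g`, for which `Q_u - Y = g`.
  simpa using hQ.2 _ (memConserved_sub hlam hL hδ hφ hf hg)

/-! ### The weight on the cube -/

theorem eLpNorm_mul_bracket_rpow_le (u : V d → ℝ) (L : ℝ) {k : ℝ} (hk : 0 ≤ k) :
    eLpNorm (fun v => u v * bracket v ^ k) 2 (volume.restrict (cube d L))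
      ≤ ENNReal.ofReal (Real.sqrt (1 + d * L ^ 2) ^ k)
        * eLpNorm u 2 (volume.restrict (cube d L)) := by
  refine eLpNorm_le_mul_eLpNorm_of_ae_le_mul
    ((ae_restrict_iff' (isOpen_cube L).measurableSet).2 (Eventually.of_forall fun v hv => ?_)) 2
  have h0 : 0 ≤ bracket v := Real.sqrt_nonneg _
  have hb : bracket v ≤ Real.sqrt (1 + d * L ^ 2) := by
    refine Real.sqrt_le_sqrt (add_le_add_right ?_ 1)
    rw [← Real.sq_sqrt (by positivity : (0 : ℝ) ≤ d * L ^ 2)]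
    exact pow_le_pow_left₀ (norm_nonneg _) (norm_le_of_abs_le fun i => (hv i).le) 2
  rw [norm_mul, mul_comm, Real.norm_of_nonneg (Real.rpow_nonneg h0 k)]
  exact mul_le_mul_of_nonneg_right (Real.rpow_le_rpow h0 hb hk) (norm_nonneg _)

/-- For `L ≥ 1` one has `1 + d L² ≤ (1 + d) L²`. The principal filter of `[1, ∞)` demands this
uniform bound, not merely an asymptotic one. -/
theorem isBigO_sqrt_one_add_rpow (d : ℕ) {k : ℝ} (hk : 0 ≤ k) :
    (fun L : ℝ => Real.sqrt (1 + d * L ^ 2) ^ k) =O[𝓟 (Ici 1)] fun L => L ^ k := by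
  refine IsBigO.of_bound (Real.sqrt (1 + d) ^ k) (eventually_principal.2 fun L hL => ?_)
  have hL1 : (1 : ℝ) ≤ L := hL
  have hL0 : 0 ≤ L := by linarith
  rw [Real.norm_of_nonneg (by positivity), Real.norm_of_nonneg (by positivity),
    ← Real.mul_rpow (Real.sqrt_nonneg _) hL0]
  refine Real.rpow_le_rpow (Real.sqrt_nonneg _) ?_ hk
  rw [Real.sqrt_le_left (by positivity), mul_pow, Real.sq_sqrt (by positivity)]
  nlinarith [d.cast_nonneg (α := ℝ)]

end Landau

theorem mainTheorem6 (d : ℕ) (hd : 1 ≤ d) :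
    (∃ C : ℝ, 0 < C ∧ ∀ k : ℝ, 0 ≤ k →
      ∃ O₁ : ℝ → ℝ, O₁ =O[𝓟 (Set.Ici 1)] (fun L : ℝ => L ^ k) ∧
      ∀ k' : ℝ, 2 ≤ k' →
      ∃ O₂ : ℝ → ℝ, O₂ =O[𝓟 (Set.Ici 1)] (fun L : ℝ => L ^ (-((d : ℝ) / 2 + k' - k))) ∧
      ∀ lam : ℝ, 0 ≤ lam → lam ≤ 1 → ∀ L : ℝ, 0 < L → ∀ N : ℕ,
      ∀ δ : ℝ, 0 < δ → δ < 1 → ∀ φ : Landau.V d → ℝ, Landau.IsCutoffProfile δ φ →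
      ∀ f : Landau.V d → ℝ, MemLp f 2 (volume.restrict (Landau.cube d L)) →
      ∀ Qc : Landau.V d → ℝ,
        Landau.IsConservedPart L (Landau.unconservedOp lam L N φ f) Qc →
        eLpNorm (fun v => (Landau.unconservedOp lam L N φ f v - Qc v) * Landau.bracket v ^ k) 2
            (volume.restrict (Landau.cube d L))
          ≤ ENNReal.ofReal (C / Real.sqrt (2 * k + 1)) *
            (ENNReal.ofReal (O₁ L) *
                Landau.distL2Norm (Landau.cube d L) (Landau.spectralError lam L N φ f)
              + ENNReal.ofReal (O₂ L *
                (Landau.moment 0 (Landau.zeroExt L f)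
                    * Landau.moment (k' + lam) (Landau.zeroExt L f)
                  + Landau.moment lam (Landau.zeroExt L f)
                    * Landau.moment k' (Landau.zeroExt L f)
                  + Landau.moment 2 (Landau.zeroExt L f)
                    * Landau.moment (k' + lam - 2) (Landau.zeroExt L f)
                  + Landau.moment (lam + 2) (Landau.zeroExt L f)
                    * Landau.moment (k' - 2) (Landau.zeroExt L f)))))
    ∧
    (∃ C : ℝ, 0 < C ∧
      ∃ O₃ : ℝ → ℝ, O₃ =O[𝓟 (Set.Ici 1)] (fun L : ℝ => L ^ (-((d : ℝ) / 2 + 2))) ∧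
      ∀ lam : ℝ, 0 ≤ lam → lam ≤ 1 → ∀ L : ℝ, 0 < L → ∀ N : ℕ,
      ∀ δ : ℝ, 0 < δ → δ < 1 → ∀ φ : Landau.V d → ℝ, Landau.IsCutoffProfile δ φ →
      ∀ f : Landau.V d → ℝ, MemLp f 2 (volume.restrict (Landau.cube d L)) →
      ∀ Qc : Landau.V d → ℝ,
        Landau.IsConservedPart L (Landau.unconservedOp lam L N φ f) Qc →
        eLpNorm (fun v => Landau.unconservedOp lam L N φ f v - Qc v) 2
            (volume.restrict (Landau.cube d L))
          ≤ ENNReal.ofReal C *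
            (Landau.distL2Norm (Landau.cube d L) (Landau.spectralError lam L N φ f)
              + ENNReal.ofReal (O₃ L *
                (Landau.moment 0 (Landau.zeroExt L f)
                    * Landau.moment (2 + lam) (Landau.zeroExt L f)
                  + Landau.moment lam (Landau.zeroExt L f)
                    * Landau.moment 2 (Landau.zeroExt L f))))) := by
  -- `O₁` carries the factor `√(2k+1)` to cancel the prefactor `1/√(2k+1)`. `O₂` and `O₃` are the
  -- comparison powers of `L` themselves: the moment terms are nonnegative in `ℝ≥0∞` and are simply
  -- added on the right.
  refine ⟨⟨1, one_pos, fun k hk => ⟨fun L => Real.sqrt (2 * k + 1) * Real.sqrt (1 + d * L ^ 2) ^ k,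
    (Landau.isBigO_sqrt_one_add_rpow d hk).const_mul_left _, fun k' _ => ⟨_, isBigO_refl _ _, ?_⟩⟩⟩,
    1, one_pos, _, isBigO_refl _ _, ?_⟩
  · intro lam hlam _ L hL N δ hδ _ φ hφ f hf Qc hQ
    have hs : 0 < Real.sqrt (2 * k + 1) := Real.sqrt_pos.2 (by linarith)
    rw [mul_add]
    refine le_add_right ?_
    rw [← mul_assoc, ← ENNReal.ofReal_mul (by positivity), ← mul_assoc,
      div_mul_cancel₀ _ hs.ne', one_mul]
    exact (Landau.eLpNorm_mul_bracket_rpow_le _ L hk).trans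
      (mul_le_mul_right (Landau.eLpNorm_unconservedOp_sub_le hlam hL hδ hφ hf hQ) _)
  · intro lam hlam _ L hL N δ hδ _ φ hφ f hf Qc hQ
    rw [ENNReal.ofReal_one, one_mul]
    exact le_add_right (Landau.eLpNorm_unconservedOp_sub_le hlam hL hδ hφ hf hQ)
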